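/- Let $\mathbb{K}=\mathbb{R}$ or $\mathbb{C}$, let $\Omega,\omega$ be non-empty sets and $\nu\colon\omega\to(0,\infty)$. Let $E$ be a Fréchet space over $\mathbb{K}$ with dual $E'$. Let $\mathcal{F}(\Omega)\subset\mathbb{K}^{\Omega}$ and $\mathcal{F}(\Omega,E)\subset E^{\Omega}$ be linear subspaces carrying locally convex Hausdorff topologies such that $\delta_x\in\mathcal{F}(\Omega)'$ for all $x\in\Omega$, and let $T^{\mathbb{K}}\colon\mathcal{F}(\Omega)\to\mathbb{K}^{\omega}$ and $T^{E}\colon\mathcal{F}(\Omega,E)\to E^{\omega}$ be linear maps; put $T^{\mathbb{K}}_x:=\delta_x\circ T^{\mathbb{K}}$ for $x\in\omega$. Let $\mathcal{F}(\Omega)'_{\kappa}$ be the dual of $\mathcal{F}(\Omega)$ with the topology of uniform convergence on the absolutely convex compact subsets of $\mathcal{F}(\Omega)$, and let $\mathcal{F}(\Omega)\varepsilon E$ be the space of continuous linear maps $\mathcal{F}(\Omega)'_{\kappa}\to E$ with the topology of uniform convergence on the equicontinuous subsets of $\mathcal{F}(\Omega)'$. For $u\in\mathcal{F}(\Omega)\varepsilon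 E$ put $S(u)(x):=u(\delta_x)$, $x\in\Omega$. Assume: 1. ($\varepsilon$-into-compatibility) $S$ is a well-defined map from $\mathcal{F}(\Omega)\varepsilon E$ to $\mathcal{F}(\Omega,E)$ and a topological isomorphism onto its image. 2. (consistency) For all $u\in\mathcal{F}(\Omega)\varepsilon E$ and $x\in\omega$: $S(u)\in\mathcal{F}(\Omega,E)$, $T^{\mathbb{K}}_x\in\mathcal{F}(\Omega)'$ and $T^{E}(S(u))(x)=u(T^{\mathbb{K}}_x)$. 3. (strength) For all $e'\in E'$, $f\in\mathcal{F}(\Omega,E)$ and $x\in\omega$: $e'\circ f\in\mathcal{F}(\Omega)$ and $T^{\mathbb{K}}(e'\circ f)(x)=e'(T^{E}(f)(x))$. 4. The space $\mathcal{F}\nu(\Omega):=\{f\in\mathcal{F}(\Omega) : |f|:=\sup_{x\in\omega}|T^{\mathbb{K}}(f)(x)|\,\nu(x)<\infty\}$ is a Banach space with respect to $|\cdot|$, and its closed unit ball $B_{\mathcal{F}\nu(\Omega)}$ is a compact subset of $\mathcal{F}(\Omega)$. 5. $U\subset\omega$ is a set of uniqueness for $(T^{\mathbb{K}},\mathcal{F}\nu)$: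 if $f\in\mathcal{F}\nu(\Omega)$ and $T^{\mathbb{K}}(f)(x)=0$ for all $x\in U$, then $f=0$. 6. $(B_n)_{n\in\mathbb{N}}$ fixes the topology in $E$: it is an increasing sequence of bounded subsets of the strong dual $E'_b$ whose polars $B_n^{\circ}=\{x\in E : |e'(x)|\le 1\text{ for all }e'\in B_n\}$ form a fundamental system of zero neighbourhoods of $E$. Let $G:=\operatorname{span}\bigl(\bigcup_{n\in\mathbb{N}}B_n\bigr)\subset E'$. Let $\mathcal{F}_{\varepsilon}\nu(\Omega,E)$ be the set of all $S(u)$ with $u\in\mathcal{F}(\Omega)\varepsilon E$ such that $u(\{y'\in\mathcal{F}(\Omega)' : |y'(f)|\le 1\text{ for all }f\in B_{\mathcal{F}\nu(\Omega)}\})$ is bounded in $E$. Let $\mathcal{F}\nu_G(U,E)$ be the space of all functions $f\colon U\to E$ such that for every $e'\in G$ there is a (necessarily unique) $f_{e'}\in\mathcal{F}\nu(\Omega)$ with $T^{\mathbb{K}}(f_{e'})(x)=e'(f(x))$ for all $x\in U$, and let $\mathcal{F}\nu_G(U,E)_{sb}$ be the subspace of those $f\in\mathcal{F}\nu_G(U,E)$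 for which $\{f_{e'} : e'\in B_n\}$ is bounded in $\mathcal{F}\nu(\Omega)$ for every $n\in\mathbb{N}$. Then the restriction map $$R_{U,G}\colon\mathcal{F}_{\varepsilon}\nu(\Omega,E)\to\mathcal{F}\nu_G(U,E)_{sb},\qquad f\mapsto(T^{E}(f)(x))_{x\in U},$$ is well-defined and surjective. -/

import Mathlib

open Set Filter Topology Bornology
open scoped ComplexOrder

noncomputable section

section EpsilonProduct

variable (𝕜 : Type*) [RCLike 𝕜]
  (F : Type*) [AddCommGroup F] [Module 𝕜 F] [TopologicalSpace F]

/-- The dual `F'_κ`: continuous linear functionals on `F` with the topology of uniform convergence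
on the absolutely convex, compact subsets of `F`. -/
abbrev KappaDual : Type _ :=
  UniformConvergenceCLM (RingHom.id 𝕜) (E := F) 𝕜 {K : Set F | AbsConvex 𝕜 K ∧ IsCompact K}

/-- Schwartz' `ε`-product `F ε E = L_e(F'_κ, E)`: continuous linear maps `F'_κ → E` with the
topology of uniform convergence on the equicontinuous subsets of `F'`. -/
abbrev EpsProduct (E : Type*) [AddCommGroup E] [Module 𝕜 E] [TopologicalSpace E] : Type _ :=
  UniformConvergenceCLM (RingHom.id 𝕜) (E := KappaDual 𝕜 F) E
    {H : Set (KappaDual 𝕜 F) | Equicontinuous (fun (h : H) (f : F) => (h : KappaDual 𝕜 F) f)}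

variable {𝕜 F}

/-- A continuous linear functional on `F`, regarded as an element of `F'_κ`. -/
def KappaDual.mk (φ : F →ₗ[𝕜] 𝕜) (hφ : Continuous φ) : KappaDual 𝕜 F :=
  ContinuousLinearMap.toUniformConvergenceCLM (RingHom.id 𝕜) 𝕜 _ ⟨φ, hφ⟩

@[simp]
theorem KappaDual.mk_apply (φ : F →ₗ[𝕜] 𝕜) (hφ : Continuous φ) (f : F) :
    KappaDual.mk φ hφ f = φ f := rfl

variable (𝕜 F) in
/-- The point evaluation `δ_x` as an element of `F'_κ`, for a space `F` of `𝕜`-valued functions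
on `Ω` on which the point evaluations are continuous. -/
def pointEval {Ω : Type*} [FunLike F Ω 𝕜] [IsAddApply F Ω 𝕜] [IsSMulApply 𝕜 F Ω 𝕜]
    [ContinuousEvalConst F Ω 𝕜] (x : Ω) : KappaDual 𝕜 F :=
  KappaDual.mk
    { toFun := fun f => f x
      map_add' := fun f g => add_apply f g x
      map_smul' := fun c f => smul_apply f c x }
    (continuous_eval_const x)

@[simp]
theorem pointEval_apply {Ω : Type*} [FunLike F Ω 𝕜] [IsAddApply F Ω 𝕜] [IsSMulApply 𝕜 F Ω 𝕜]
    [ContinuousEvalConst F Ω 𝕜] (x : Ω) (f : F) : pointEval 𝕜 F x f = f x := rfl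

/-- The function `S(u) : Ω → E`, `x ↦ u(δ_x)`, for `u ∈ F ε E`. -/
def epsFun {Ω : Type*} [FunLike F Ω 𝕜] [IsAddApply F Ω 𝕜] [IsSMulApply 𝕜 F Ω 𝕜]
    [ContinuousEvalConst F Ω 𝕜] {E : Type*} [AddCommGroup E] [Module 𝕜 E] [TopologicalSpace E]
    (u : EpsProduct 𝕜 F E) (x : Ω) : E :=
  u (pointEval 𝕜 F x)

end EpsilonProduct

section Families

variable {𝕜 : Type*} [RCLike 𝕜] {Ω ω : Type*}
  {F : Type*} [FunLike F Ω 𝕜] [AddCommGroup F] [Module 𝕜 F]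
  [IsAddApply F Ω 𝕜] [IsSMulApply 𝕜 F Ω 𝕜] [TopologicalSpace F] [ContinuousEvalConst F Ω 𝕜]
  {E : Type*} [AddCommGroup E] [Module 𝕜 E] [TopologicalSpace E]
  {FE : Type*} [FunLike FE Ω E] [AddCommGroup FE] [Module 𝕜 FE]

variable (𝕜 F E FE) in
/-- `F` and `FE` are `ε`-into-compatible: `u ↦ S(u)` is a well-defined map `F ε E → FE` and an
isomorphism onto its image (it is automatically linear, since the operations of both spaces
are pointwise). -/
def EpsIntoCompatible [IsTopologicalAddGroup E] [TopologicalSpace FE] : Prop :=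
  ∃ S : EpsProduct 𝕜 F E → FE, (∀ u x, S u x = epsFun u x) ∧ IsEmbedding S

/-- The functional `T_x = δ_x ∘ T` on `F`. -/
def coordFunctional (T : F →ₗ[𝕜] (ω → 𝕜)) (x : ω) : F →ₗ[𝕜] 𝕜 :=
  (LinearMap.proj x).comp T

/-- `(TE, TK)` is a consistent family: for every `u ∈ F ε E` one has `S(u) ∈ FE`, and for all
`x ∈ ω`, `TK_x ∈ F'` and `TE (S u) x = u (TK_x)`. -/
def IsConsistentFamily (TE : FE →ₗ[𝕜] (ω → E)) (TK : F →ₗ[𝕜] (ω → 𝕜)) : Prop :=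
  ∃ hT : ∀ x : ω, Continuous (coordFunctional TK x),
    ∀ u : EpsProduct 𝕜 F E, ∃ f : FE, (∀ x : Ω, f x = epsFun u x) ∧
      ∀ x : ω, TE f x = u (KappaDual.mk (coordFunctional TK x) (hT x))

/-- `(TE, TK)` is a strong family: for all `e' ∈ E'` and `f ∈ FE` one has `e' ∘ f ∈ F` and
`TK (e' ∘ f) = e' ∘ TE f`. -/
def IsStrongFamily (TE : FE →ₗ[𝕜] (ω → E)) (TK : F →ₗ[𝕜] (ω → 𝕜)) : Prop :=
  ∀ (e' : StrongDual 𝕜 E) (f : FE), ∃ g : F, (∀ x : Ω, g x = e' (f x)) ∧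
    ∀ x : ω, TK g x = e' (TE f x)

end Families

section WeightedSpace

variable {𝕜 : Type*} [RCLike 𝕜] {ω : Type*} {F : Type*} [AddCommGroup F] [Module 𝕜 F]

/-- The elements `f` of `F` with `sup_x |T f x| ν(x) < ∞`. -/
def weightedSubmodule (T : F →ₗ[𝕜] (ω → 𝕜)) (ν : ω → Ioi (0 : ℝ)) : Submodule 𝕜 F where
  carrier := {f | BddAbove (range fun x => ‖T f x‖ * (ν x : ℝ))}
  zero_mem' := ⟨0, by rintro _ ⟨x, rfl⟩; simp⟩
  add_mem' := by
    rintro f g ⟨a, ha⟩ ⟨b, hb⟩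
    refine ⟨a + b, ?_⟩
    rintro _ ⟨x, rfl⟩
    have h1 := ha ⟨x, rfl⟩
    have h2 := hb ⟨x, rfl⟩
    have h3 : (0 : ℝ) < ν x := (ν x).2
    have h4 := mul_le_mul_of_nonneg_right (norm_add_le (T f x) (T g x)) h3.le
    simp only [map_add, Pi.add_apply] at h1 h2 ⊢
    linarith
  smul_mem' := by
    rintro c f ⟨a, ha⟩
    refine ⟨‖c‖ * a, ?_⟩
    rintro _ ⟨x, rfl⟩
    have h1 := mul_le_mul_of_nonneg_left (ha ⟨x, rfl⟩) (norm_nonneg c)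
    simpa [mul_assoc] using h1

/-- The weighted space `Fν(Ω)`, carrying the topology given by the seminorm
`|f| = sup_x |T f x| ν(x)` (not the one induced by `F`). -/
def WeightedSpace (T : F →ₗ[𝕜] (ω → 𝕜)) (ν : ω → Ioi (0 : ℝ)) : Type _ :=
  weightedSubmodule T ν

namespace WeightedSpace

variable (T : F →ₗ[𝕜] (ω → 𝕜)) (ν : ω → Ioi (0 : ℝ))

instance : AddCommGroup (WeightedSpace T ν) := inferInstanceAs (AddCommGroup (weightedSubmodule T ν))

instance : Module 𝕜 (WeightedSpace T ν) := inferInstanceAs (Module 𝕜 (weightedSubmodule T ν))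

/-- The inclusion `Fν(Ω) → F(Ω)`. -/
def incl : WeightedSpace T ν →ₗ[𝕜] F := (weightedSubmodule T ν).subtype

variable {T ν} in
theorem bddAbove (f : WeightedSpace T ν) :
    BddAbove (range fun x => ‖T (incl T ν f) x‖ * (ν x : ℝ)) :=
  Subtype.property (p := (· ∈ weightedSubmodule T ν)) f

/-- The seminorm `|f| = sup_x |T f x| ν(x)` on `Fν(Ω)`. -/
def weightedSeminorm : Seminorm 𝕜 (WeightedSpace T ν) :=
  Seminorm.of (fun f => ⨆ x, ‖T (incl T ν f) x‖ * (ν x : ℝ))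
    (by
      intro f g
      rcases isEmpty_or_nonempty ω with h | h
      · simp
      refine ciSup_le fun x => ?_
      have h3 : (0 : ℝ) < ν x := (ν x).2
      have h1 := le_ciSup (bddAbove f) x
      have h2 := le_ciSup (bddAbove g) x
      have h4 := mul_le_mul_of_nonneg_right
        (norm_add_le (T (incl T ν f) x) (T (incl T ν g) x)) h3.le
      simp only [map_add, Pi.add_apply] at h1 h2 ⊢
      linarith)
    (by
      intro c f
      simp only [map_smul, Pi.smul_apply, smul_eq_mul, norm_mul, mul_assoc]
      exact (Real.mul_iSup_of_nonneg (norm_nonneg c) _).symm)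

instance : SeminormedAddCommGroup (WeightedSpace T ν) :=
  (weightedSeminorm T ν).toAddGroupSeminorm.toSeminormedAddCommGroup

variable {T ν} in
theorem norm_def (f : WeightedSpace T ν) :
    ‖f‖ = ⨆ x, ‖T (incl T ν f) x‖ * (ν x : ℝ) := rfl

instance : NormedSpace 𝕜 (WeightedSpace T ν) where
  norm_smul_le c f := (map_smul_eq_mul (weightedSeminorm T ν) c f).le

/-- The closed unit ball of `Fν(Ω)`, as a subset of `F(Ω)`. -/
def unitBall : Set F := incl T ν '' Metric.closedBall 0 1

end WeightedSpace

/-- `U ⊆ ω` is a set of uniqueness for `(T, Fν)`. -/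
def IsSetOfUniqueness (T : F →ₗ[𝕜] (ω → 𝕜)) (ν : ω → Ioi (0 : ℝ)) (U : Set ω) : Prop :=
  ∀ f : WeightedSpace T ν, (∀ x ∈ U, T (WeightedSpace.incl T ν f) x = 0) → f = 0

end WeightedSpace

section Spaces

variable {𝕜 : Type*} [RCLike 𝕜] {E : Type*} [AddCommGroup E] [Module 𝕜 E] [TopologicalSpace E]

/-- An increasing sequence of bounded subsets of the strong dual `E'_b` fixes the topology in `E`
if the polars `B_n° = {x ∈ E | ∀ e' ∈ B_n, |e'(x)| ≤ 1}` form a fundamental system of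
zero neighbourhoods of `E`. -/
structure FixesTopology (B : ℕ → Set (StrongDual 𝕜 E)) : Prop where
  monotone : Monotone B
  bounded : ∀ n, IsVonNBounded 𝕜 (B n)
  hasBasis : (𝓝 (0 : E)).HasBasis (fun _ : ℕ => True)
    (fun n => {x : E | ∀ e' ∈ B n, ‖e' x‖ ≤ 1})

variable {ω : Type*} {F : Type*} [AddCommGroup F] [Module 𝕜 F]
  (TK : F →ₗ[𝕜] (ω → 𝕜)) (ν : ω → Ioi (0 : ℝ)) (U : Set ω)

/-- `g ∈ Fν(Ω)` satisfies `TK g = e' ∘ f` on `U`, i.e. `g` is a function `f_{e'}`. If `U` is a set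
of uniqueness, there is at most one such `g`. -/
def IsScalarExtension (f : U → E) (e' : StrongDual 𝕜 E) (g : WeightedSpace TK ν) : Prop :=
  ∀ x : U, TK (WeightedSpace.incl TK ν g) x = e' (f x)

/-- The restriction space `Fν_G(U, E)`. -/
def restrictionSpace (G : Submodule 𝕜 (StrongDual 𝕜 E)) : Set (U → E) :=
  {f | ∀ e' ∈ G, ∃ g : WeightedSpace TK ν, IsScalarExtension TK ν U f e' g}

/-- The restriction space `Fν_G(U, E)_sb` for `G = span (⋃ n, B n)`: those `f ∈ Fν_G(U, E)` for
which `{f_{e'} | e' ∈ B n}` is bounded in `Fν(Ω)` for every `n`. -/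
def sbRestrictionSpace (B : ℕ → Set (StrongDual 𝕜 E)) : Set (U → E) :=
  {f | f ∈ restrictionSpace TK ν U (Submodule.span 𝕜 (⋃ n, B n)) ∧
    ∀ n, Bornology.IsBounded {g : WeightedSpace TK ν | ∃ e' ∈ B n, IsScalarExtension TK ν U f e' g}}

variable {Ω : Type*} [FunLike F Ω 𝕜] [IsAddApply F Ω 𝕜] [IsSMulApply 𝕜 F Ω 𝕜]
  [TopologicalSpace F] [ContinuousEvalConst F Ω 𝕜]
  (FE : Type*) [FunLike FE Ω E]

/-- The space `F_ε ν(Ω, E) = S({u ∈ F ε E | u(B°) is bounded in E})`, where `B°` is the polar in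
`F'` of the closed unit ball `B` of `Fν(Ω)`. -/
def epsWeightedSpace : Set FE :=
  {f | ∃ u : EpsProduct 𝕜 F E,
    IsVonNBounded 𝕜
      (u '' {y' : KappaDual 𝕜 F | ∀ g ∈ WeightedSpace.unitBall TK ν, ‖y' g‖ ≤ 1}) ∧
    ∀ x : Ω, f x = epsFun u x}

/-- The restriction map `f ↦ (TE f x)_{x ∈ U}`. -/
def restrictionMap {FE : Type*} [AddCommGroup FE] [Module 𝕜 FE]
    (TE : FE →ₗ[𝕜] (ω → E)) (U : Set ω) (f : FE) : U → E :=
  fun x => TE f x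

end Spaces

end

/-! ### Duality between a compact absolutely convex set and `F'`. -/

section Duality

variable {𝕜 : Type*} [RCLike 𝕜] {F : Type*} [AddCommGroup F] [Module 𝕜 F]

/-! Let `K` be the unit ball of `Fν(Ω)`. For surjectivity, a preimage of `f` comes from an operator
`u` with `e'(u y) = y(f_{e'})` for `e' ∈ B n`. If `y = T_x` with `x ∈ U`, the vector `f x` serves as
`u y`. By uniqueness these `T_x` separate `K` from `0`, so their span is dense in `F'` uniformly on
`K`: a functional on `C(K)` killing the span restricts to a multiple of evaluation at a point of
`K`, which must be `0`. Boundedness of `{f_{e'} | e' ∈ B n}` gives `|y(f_{e'})| ≤ C n * sup_K |y|`.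
Hence approximants of `y` yield a Cauchy sequence in `E`, and completeness defines `u y`. The same
estimate makes `u` continuous on `F'_κ` and bounded on the polar of `K`. Conversely, `ν(x) T_x` lies
in that polar, so the vectors `ν(x) TE f x` stay in a bounded set, which bounds the norms of the
`f_{e'}`. -/

theorem Balanced.norm_le_of_forall_re_le {K : Set F} (hK : Balanced 𝕜 K) (w : F →ₗ[𝕜] 𝕜) {r : ℝ}
    (h : ∀ g ∈ K, RCLike.re (w g) ≤ r) {g : F} (hg : g ∈ K) : ‖w g‖ ≤ r := by
  obtain ⟨c, hc, hcw⟩ := RCLike.exists_norm_eq_mul_self (w g)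
  have h1 := h (c • g) (hK.smul_mem hc.le hg)
  rwa [map_smul, smul_eq_mul, ← hcw, RCLike.ofReal_re] at h1

variable [TopologicalSpace F]

/-- A linear functional on the dual of `F` that is dominated by the supremum over a nonempty
absolutely convex compact set `K` is the evaluation at a point of `K`. -/
theorem KappaDual.exists_mem_forall_eq_apply {K : Set F} (hK : AbsConvex 𝕜 K) (hc : IsCompact K)
    (φ : KappaDual 𝕜 F →ₗ[𝕜] 𝕜)
    (hφ : ∀ y r, (∀ g ∈ K, ‖y g‖ ≤ r) → ‖φ y‖ ≤ r) : ∃ g ∈ K, ∀ y, y g = φ y := by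
  classical
  suffices h : (K ∩ ⋂ y : KappaDual 𝕜 F, {g | y g = φ y}).Nonempty by
    obtain ⟨g, hg, hg'⟩ := h
    exact ⟨g, hg, fun y => mem_iInter.1 hg' y⟩
  have hcont (y : KappaDual 𝕜 F) : Continuous y := map_continuous y
  refine hc.inter_iInter_nonempty _
    (fun y => isClosed_eq (hcont y) continuous_const) fun s => ?_
  -- By compactness only finitely many equations `y g = φ y` need solving at once, a question in
  -- `𝕜^s`.
  let L : F →ₗ[𝕜] (s → 𝕜) := LinearMap.pi fun y => (y.1 : F →ₗ[𝕜] 𝕜)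
  have hL (g : F) (y : s) : L g y = y.1 g := rfl
  have hLc : Continuous L := continuous_pi fun y => hcont y.1
  suffices h : (fun y : s => φ y) ∈ L '' K by
    obtain ⟨g, hg, hg'⟩ := h
    refine ⟨g, hg, mem_iInter₂.2 fun y hy => ?_⟩
    exact congrFun hg' ⟨y, hy⟩
  by_contra hn
  obtain ⟨l, r, hl, hr⟩ := RCLike.geometric_hahn_banach_closed_point (𝕜 := 𝕜)
    (convex_RCLike_iff_convex_real.1 (hK.2.linear_image L)) (hc.image hLc).isClosed hn
  let c (y : s) : 𝕜 := l fun j => if y = j then 1 else 0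
  have hl' (v : s → 𝕜) : l v = ∑ y, c y * v y := by
    simpa [mul_comm] using (l : (s → 𝕜) →ₗ[𝕜] 𝕜).pi_apply_eq_sum_univ v
  -- The separating functional on `𝕜^s` pulls back along `L` to this `w ∈ F'`, which violates the
  -- domination of `φ`.
  let w : KappaDual 𝕜 F := ∑ y : s, c y • y.1
  have hw (g : F) : w g = l (L g) := by
    rw [hl']
    simp [w, hL, sum_apply]
  have hφw : φ w = l (fun y => φ y) := by
    rw [hl']
    simp [w]
  have h1 : ‖φ w‖ ≤ r := hφ w r fun g hg =>
    hK.1.norm_le_of_forall_re_le (w : F →ₗ[𝕜] 𝕜)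
      (fun g hg => by simpa [hw] using (hl _ (mem_image_of_mem L hg)).le) hg
  exact absurd ((RCLike.re_le_norm _).trans h1) (by rw [hφw]; exact not_le.2 hr)

theorem Submodule.exists_strongDual_eq_zero_of_notMem_closure {X : Type*} [NormedAddCommGroup X]
    [NormedSpace 𝕜 X] (W : Submodule 𝕜 X) {x : X} (hx : x ∉ closure (W : Set X)) :
    ∃ φ : StrongDual 𝕜 X, (∀ w ∈ W, φ w = 0) ∧ φ x ≠ 0 := by
  let := NormedSpace.restrictScalars ℝ 𝕜 X
  have : IsScalarTower ℝ 𝕜 X := RestrictScalars.isScalarTower ℝ 𝕜 X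
  have hconv : Convex ℝ (closure (W : Set X)) :=
    Convex.closure (convex_RCLike_iff_convex_real (K := 𝕜).1 W.convex)
  obtain ⟨φ, r, h1, h2⟩ := RCLike.geometric_hahn_banach_closed_point (𝕜 := 𝕜)
    hconv isClosed_closure hx
  have h0 : 0 < r := by simpa using h1 0 (subset_closure W.zero_mem)
  refine ⟨φ, fun w hw => by_contra fun hne => ?_, fun h => ?_⟩
  -- The multiple of `w` on which `φ` takes exactly the forbidden value `r`.
  · have := h1 (((r : 𝕜) / φ w) • w) (subset_closure (W.smul_mem _ hw))
    rw [map_smul, smul_eq_mul, div_mul_cancel₀ _ hne, RCLike.ofReal_re] at this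
    exact this.false
  · rw [h, map_zero] at h2
    exact h2.not_gt h0

/-- A set of functionals that separates the points of an absolutely convex compact set `K` from `0`
spans a dense subspace of the dual for the topology of uniform convergence on `K`. -/
theorem KappaDual.exists_mem_span_forall_norm_sub_le {K : Set F} (hK : AbsConvex 𝕜 K)
    (hc : IsCompact K) {S : Set (KappaDual 𝕜 F)} (hS : ∀ g ∈ K, (∀ y ∈ S, y g = 0) → g = 0)
    (y : KappaDual 𝕜 F) {ε : ℝ} (hε : 0 < ε) :
    ∃ d ∈ Submodule.span 𝕜 S, ∀ g ∈ K, ‖y g - d g‖ ≤ ε := by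
  have : CompactSpace K := isCompact_iff_compactSpace.1 hc
  let ρ : KappaDual 𝕜 F →ₗ[𝕜] C(K, 𝕜) :=
    { toFun := fun y => ⟨fun g => y g.1, (map_continuous y).comp continuous_subtype_val⟩
      map_add' := fun _ _ => rfl
      map_smul' := fun _ _ => rfl }
  have hρ (y : KappaDual 𝕜 F) (g : K) : ρ y g = y g.1 := rfl
  by_cases hy : ρ y ∈ closure (((Submodule.span 𝕜 S).map ρ : Submodule 𝕜 C(K, 𝕜)) : Set C(K, 𝕜))
  · obtain ⟨_, ⟨d, hd, rfl⟩, hlt⟩ := Metric.mem_closure_iff.1 hy ε hε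
    refine ⟨d, hd, fun g hg => ?_⟩
    rw [dist_eq_norm] at hlt
    exact ((ρ y - ρ d).norm_coe_le_norm ⟨g, hg⟩).trans hlt.le
  · exfalso
    obtain ⟨φ, h0, h1⟩ := Submodule.exists_strongDual_eq_zero_of_notMem_closure _ hy
    have hpos : 0 < ‖φ‖ := norm_pos_iff.2 fun h => h1 (by simp [h])
    have hne : (‖φ‖ : 𝕜) ≠ 0 := RCLike.ofReal_ne_zero.2 hpos.ne'
    rcases K.eq_empty_or_nonempty with rfl | ⟨g₀, hg₀⟩
    · exact h1 (by rw [Subsingleton.elim (ρ y) 0, map_zero])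
    -- Dividing by `‖φ‖` makes the functional dominated by the supremum over `K`.
    obtain ⟨g, hg, hg'⟩ := exists_mem_forall_eq_apply hK hc
      ((‖φ‖ : 𝕜)⁻¹ • (φ : C(K, 𝕜) →ₗ[𝕜] 𝕜).comp ρ) fun z r hr => by
        have hr0 : 0 ≤ r := (norm_nonneg _).trans (hr g₀ hg₀)
        have hz : ‖ρ z‖ ≤ r := (ContinuousMap.norm_le _ hr0).2 fun g => hr g.1 g.2
        simp only [LinearMap.smul_apply, LinearMap.comp_apply, ContinuousLinearMap.coe_coe,
          norm_smul, norm_inv, RCLike.norm_ofReal, abs_norm]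
        rw [inv_mul_le_iff₀ hpos]
        exact (φ.le_opNorm _).trans (by gcongr)
    have hg0 : g = 0 := hS g hg fun z hz => by
      rw [hg']
      simp [h0 _ (Submodule.mem_map_of_mem (Submodule.subset_span hz))]
    have := hg' y
    rw [hg0, map_zero] at this
    simp [hne, h1] at this

end Duality

/-! ### Constructing the operator from its scalar values. -/

section FixesTopology

variable {𝕜 : Type*} [RCLike 𝕜] {E : Type*} [AddCommGroup E] [Module 𝕜 E]

theorem FixesTopology.eq_of_forall_apply_eq [TopologicalSpace E] [T2Space E]
    {B : ℕ → Set (StrongDual 𝕜 E)} (hB : FixesTopology B) {x y : E}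
    (h : ∀ n, ∀ e' ∈ B n, e' x = e' y) : x = y := by
  by_contra hne
  have hmem : {z : E | z ≠ x - y} ∈ 𝓝 (0 : E) :=
    isOpen_ne.mem_nhds (sub_ne_zero.2 hne).symm
  obtain ⟨n, -, hn⟩ := hB.hasBasis.mem_iff.1 hmem
  have : x - y ∈ {x : E | ∀ e' ∈ B n, ‖e' x‖ ≤ 1} := fun e' he' => by simp [h n e' he']
  exact hn this rfl

variable {F : Type*} [AddCommGroup F] [Module 𝕜 F] [TopologicalSpace F]
  [UniformSpace E] [IsUniformAddGroup E]

/-- The vectors in a complete space `E` representing `y ∘ h`, where `h` is a map from `⋃ n, B n`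
to `F`, exist for all `y ∈ F'` as soon as they exist on a subset of `F'` that separates the points
of `K` from `0`. -/
theorem FixesTopology.exists_forall_apply_eq [CompleteSpace E]
    {B : ℕ → Set (StrongDual 𝕜 E)} (hB : FixesTopology B)
    {K : Set F} (hK : AbsConvex 𝕜 K) (hc : IsCompact K)
    {S : Set (KappaDual 𝕜 F)} (hS : ∀ g ∈ K, (∀ y ∈ S, y g = 0) → g = 0)
    {h : StrongDual 𝕜 E → F} {C : ℕ → ℝ}
    (hh : ∀ n, ∀ e' ∈ B n, ∀ (y : KappaDual 𝕜 F) r,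
      (∀ g ∈ K, ‖y g‖ ≤ r) → ‖y (h e')‖ ≤ C n * r)
    (hval : ∀ y ∈ S, ∃ x : E, ∀ n, ∀ e' ∈ B n, e' x = y (h e')) (y : KappaDual 𝕜 F) :
    ∃ x : E, ∀ n, ∀ e' ∈ B n, e' x = y (h e') := by
  have hspan : ∀ y ∈ Submodule.span 𝕜 S, ∃ x : E, ∀ n, ∀ e' ∈ B n, e' x = y (h e') := by
    intro y hy
    induction hy using Submodule.span_induction with
    | mem y hy => exact hval y hy
    | zero => exact ⟨0, by simp⟩
    | add y z _ _ hy hz =>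
      obtain ⟨a, ha⟩ := hy
      obtain ⟨b, hb⟩ := hz
      exact ⟨a + b, fun n e' he' => by simp [ha n e' he', hb n e' he']⟩
    | smul c y _ hy =>
      obtain ⟨a, ha⟩ := hy
      exact ⟨c • a, fun n e' he' => by simp [ha n e' he']⟩
  choose d hd hdK using fun k : ℕ =>
    KappaDual.exists_mem_span_forall_norm_sub_le hK hc hS y (Nat.one_div_pos_of_nat (α := ℝ) (n := k))
  choose x hx using fun k => hspan (d k) (hd k)
  have hlim (n : ℕ) : Tendsto (fun k : ℕ => C n * (1 / ((k : ℝ) + 1))) atTop (𝓝 0) := by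
    simpa using tendsto_one_div_add_atTop_nhds_zero_nat.const_mul (C n)
  have hdist (n : ℕ) (e' : StrongDual 𝕜 E) (he' : e' ∈ B n) (k : ℕ) :
      ‖e' (x k) - y (h e')‖ ≤ C n * (1 / ((k : ℝ) + 1)) := by
    rw [hx k n e' he', norm_sub_rev, ← sub_apply]
    exact hh n e' he' _ _ fun g hg => by simpa using hdK k g hg
  have hcauchy : CauchySeq x := by
    refine hB.hasBasis.uniformity_of_nhds_zero.cauchySeq_iff.2 fun n _ => ?_
    -- Two errors of at most `1/2` keep differences in the polar of `B n`.
    obtain ⟨N, hN⟩ := eventually_atTop.1 ((hlim n).eventually_le_const (half_pos one_pos))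
    refine ⟨N, fun k hk l hl e' he' => ?_⟩
    have h1 := (hdist n e' he' k).trans (hN k hk)
    have h2 := (hdist n e' he' l).trans (hN l hl)
    have h3 := norm_sub_le_norm_sub_add_norm_sub (e' (x l)) (y (h e')) (e' (x k))
    rw [norm_sub_rev (y (h e'))] at h3
    rw [map_sub]
    linarith
  obtain ⟨a, ha⟩ := cauchySeq_tendsto_of_complete hcauchy
  refine ⟨a, fun n e' he' => tendsto_nhds_unique ((e'.continuous.tendsto a).comp ha) ?_⟩
  rw [tendsto_iff_norm_sub_tendsto_zero]
  exact squeeze_zero (fun _ => norm_nonneg _) (hdist n e' he') (hlim n)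

/-- The `B n` separate points of `E`, which forces linearity. Continuity holds because `sup_K |y|`
is a continuous seminorm on `F'_κ`. -/
theorem FixesTopology.exists_epsProduct [ContinuousSMul 𝕜 E] [CompleteSpace E] [T2Space E]
    {B : ℕ → Set (StrongDual 𝕜 E)} (hB : FixesTopology B)
    {K : Set F} (hK : AbsConvex 𝕜 K) (hc : IsCompact K)
    {S : Set (KappaDual 𝕜 F)} (hS : ∀ g ∈ K, (∀ y ∈ S, y g = 0) → g = 0)
    {h : StrongDual 𝕜 E → F} {C : ℕ → ℝ} (hC : ∀ n, 0 < C n)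
    (hh : ∀ n, ∀ e' ∈ B n, ∀ (y : KappaDual 𝕜 F) r,
      (∀ g ∈ K, ‖y g‖ ≤ r) → ‖y (h e')‖ ≤ C n * r)
    (hval : ∀ y ∈ S, ∃ x : E, ∀ n, ∀ e' ∈ B n, e' x = y (h e')) :
    ∃ u : EpsProduct 𝕜 F E, ∀ y n, ∀ e' ∈ B n, e' (u y) = y (h e') := by
  choose u hu using hB.exists_forall_apply_eq hK hc hS hh hval
  let v : KappaDual 𝕜 F →ₗ[𝕜] E :=
    { toFun := u
      map_add' := fun y z => hB.eq_of_forall_apply_eq fun n e' he' => by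
        simp [hu _ n e' he']
      map_smul' := fun c y => hB.eq_of_forall_apply_eq fun n e' he' => by
        simp [hu _ n e' he'] }
  have hv : Continuous v := by
    refine continuous_of_continuousAt_zero v ?_
    rw [ContinuousAt, map_zero]
    refine hB.hasBasis.tendsto_right_iff.2 fun n _ => ?_
    filter_upwards [UniformConvergenceCLM.eventually_nhds_zero_mapsTo (RingHom.id 𝕜)
      (𝔖 := {K : Set F | AbsConvex 𝕜 K ∧ IsCompact K}) ⟨hK, hc⟩
      (Metric.closedBall_mem_nhds (0 : 𝕜) (inv_pos.2 (hC n)))] with y hy e' he'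
    have := hh n e' he' y (C n)⁻¹ fun g hg => by simpa using hy hg
    rw [mul_inv_cancel₀ (hC n).ne'] at this
    rwa [← hu y n e' he'] at this
  exact ⟨ContinuousLinearMap.toUniformConvergenceCLM (RingHom.id 𝕜) E _ ⟨v, hv⟩, hu⟩

end FixesTopology

/-! ### The weighted space and its unit ball. -/

section WeightedSpace

variable {𝕜 : Type*} [RCLike 𝕜] {ω : Type*} {F : Type*} [AddCommGroup F] [Module 𝕜 F]
  {T : F →ₗ[𝕜] (ω → 𝕜)} {ν : ω → Ioi (0 : ℝ)}

namespace WeightedSpace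

theorem absConvex_unitBall : AbsConvex 𝕜 (unitBall T ν) := by
  refine ⟨?_, ?_⟩
  · rintro c hc _ ⟨_, ⟨g, hg, rfl⟩, rfl⟩
    refine ⟨c • g, ?_, map_smul _ _ _⟩
    rw [mem_closedBall_zero_iff] at hg ⊢
    exact (norm_smul_le c g).trans (mul_le_one₀ hc (norm_nonneg _) hg)
  · refine Convex.linear_image ?_ (incl T ν)
    intro a ha b hb s t hs ht hst
    rw [mem_closedBall_zero_iff] at ha hb ⊢
    obtain ⟨s, hs', rfl⟩ := RCLike.nonneg_iff_exists_ofReal.1 hs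
    obtain ⟨t, ht', rfl⟩ := RCLike.nonneg_iff_exists_ofReal.1 ht
    have hst' : s + t = 1 := by exact_mod_cast hst
    refine (norm_add_le _ _).trans ?_
    rw [norm_smul, norm_smul, RCLike.norm_ofReal, RCLike.norm_ofReal, abs_of_nonneg hs',
      abs_of_nonneg ht']
    nlinarith

theorem norm_apply_le (g : WeightedSpace T ν) (x : ω) : ‖T (incl T ν g) x‖ * (ν x : ℝ) ≤ ‖g‖ :=
  le_ciSup (bddAbove g) x

theorem norm_le_of_forall_le [Nonempty ω] {g : WeightedSpace T ν} {r : ℝ}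
    (h : ∀ x, ‖T (incl T ν g) x‖ * (ν x : ℝ) ≤ r) : ‖g‖ ≤ r :=
  ciSup_le h

/-- Scaling by a positive bound `C` instead of `‖g‖` avoids dividing by zero. -/
theorem norm_map_incl_le (φ : F →ₗ[𝕜] 𝕜) {r C : ℝ} (hφ : ∀ g ∈ unitBall T ν, ‖φ g‖ ≤ r)
    {g : WeightedSpace T ν} (hC : 0 < C) (hg : ‖g‖ ≤ C) : ‖φ (incl T ν g)‖ ≤ C * r := by
  have h1 : ‖(C : 𝕜)⁻¹ • g‖ ≤ 1 := by
    rw [norm_smul, norm_inv, RCLike.norm_ofReal, abs_of_pos hC, inv_mul_le_iff₀ hC, mul_one]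
    exact hg
  have h2 := hφ _ ⟨(C : 𝕜)⁻¹ • g, mem_closedBall_zero_iff.2 h1, rfl⟩
  rwa [map_smul, map_smul, norm_smul, norm_inv, RCLike.norm_ofReal, abs_of_pos hC,
    inv_mul_le_iff₀ hC] at h2

end WeightedSpace

theorem IsSetOfUniqueness.eq_of_isScalarExtension {U : Set ω} (hU : IsSetOfUniqueness T ν U)
    {E : Type*} [AddCommGroup E] [Module 𝕜 E] [TopologicalSpace E] {f : U → E}
    {e' : StrongDual 𝕜 E} {g h : WeightedSpace T ν} (hg : IsScalarExtension T ν U f e' g)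
    (hh : IsScalarExtension T ν U f e' h) : g = h :=
  sub_eq_zero.1 <| hU _ fun x hx => by simp [hg ⟨x, hx⟩, hh ⟨x, hx⟩]

end WeightedSpace

/-! ### The restriction map. -/

section Restriction

variable {𝕜 : Type*} [RCLike 𝕜] {Ω ω : Type*}
  {E : Type*} [AddCommGroup E] [Module 𝕜 E]
  {F : Type*} [FunLike F Ω 𝕜] [AddCommGroup F] [Module 𝕜 F]
  [IsAddApply F Ω 𝕜] [IsSMulApply 𝕜 F Ω 𝕜] [TopologicalSpace F] [ContinuousEvalConst F Ω 𝕜]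
  {FE : Type*} [FunLike FE Ω E] [AddCommGroup FE] [Module 𝕜 FE]
  {TE : FE →ₗ[𝕜] (ω → E)} {TK : F →ₗ[𝕜] (ω → 𝕜)} {ν : ω → Ioi (0 : ℝ)}

theorem mapsTo_restrictionMap [Nonempty ω] [TopologicalSpace E]
    [IsTopologicalAddGroup E] [ContinuousSMul 𝕜 E]
    (hstrong : IsStrongFamily TE TK) (hconsistent : IsConsistentFamily TE TK)
    {B : ℕ → Set (StrongDual 𝕜 E)} (hB : FixesTopology B)
    {U : Set ω} (hU : IsSetOfUniqueness TK ν U) :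
    MapsTo (restrictionMap TE U) (epsWeightedSpace TK ν FE) (sbRestrictionSpace TK ν U B) := by
  rintro f ⟨u, hu, hfu⟩
  obtain ⟨hT, hcons⟩ := hconsistent
  obtain ⟨f', hf', hTE⟩ := hcons u
  obtain rfl : f' = f := DFunLike.ext _ _ fun x => (hf' x).trans (hfu x).symm
  set A := u '' {y' : KappaDual 𝕜 F | ∀ g ∈ WeightedSpace.unitBall TK ν, ‖y' g‖ ≤ 1}
  have hmem (x : ω) : ((ν x : ℝ) : 𝕜) • TE f' x ∈ A := by
    refine ⟨((ν x : ℝ) : 𝕜) • KappaDual.mk (coordFunctional TK x) (hT x), ?_, ?_⟩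
    · rintro _ ⟨g, hg, rfl⟩
      have h1 := WeightedSpace.norm_apply_le g x
      have hν : (0 : ℝ) < ν x := (ν x).2
      rw [smul_apply, norm_smul, RCLike.norm_ofReal, abs_of_pos hν, mul_comm]
      exact h1.trans (mem_closedBall_zero_iff.1 hg)
    · rw [map_smul, hTE]
  -- By strength `e' ∘ f'` is the scalar extension, and its norm is a supremum of `e'` over points
  -- of `A`.
  have key (e' : StrongDual 𝕜 E) (r : ℝ) (hr : ∀ a ∈ A, ‖e' a‖ ≤ r) :
      ∃ g : WeightedSpace TK ν, IsScalarExtension TK ν U (restrictionMap TE U f') e' g ∧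
        ‖g‖ ≤ r := by
    obtain ⟨g, -, hg⟩ := hstrong e' f'
    have hle (x : ω) : ‖TK g x‖ * (ν x : ℝ) ≤ r := by
      have hν : (0 : ℝ) < ν x := (ν x).2
      have := hr _ (hmem x)
      rwa [map_smul, norm_smul, RCLike.norm_ofReal, abs_of_pos hν, ← hg, mul_comm] at this
    let g' : WeightedSpace TK ν := ⟨g, r, forall_mem_range.2 hle⟩
    exact ⟨g', fun x => hg x, WeightedSpace.norm_le_of_forall_le (g := g') hle⟩
  refine ⟨fun e' _ => ?_, fun n => ?_⟩
  · obtain ⟨r, hr⟩ := (NormedSpace.isVonNBounded_iff' 𝕜).1 (hu.image e')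
    obtain ⟨g, hg, -⟩ := key e' r fun a ha => hr _ (mem_image_of_mem _ ha)
    exact ⟨g, hg⟩
  -- Strongly bounded `B n` and bounded `A` give one bound for all `e' a`.
  · obtain ⟨r, hr⟩ := (NormedSpace.isVonNBounded_iff' 𝕜).1
      (ContinuousLinearMap.isVonNBounded_image2_apply (hB.bounded n) hu)
    refine isBounded_iff_forall_norm_le.2 ⟨r, ?_⟩
    rintro g ⟨e', he', hg⟩
    obtain ⟨g', hg', hle⟩ := key e' r fun a ha => hr _ (mem_image2_of_mem he' ha)
    rwa [hU.eq_of_isScalarExtension hg hg']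

theorem surjOn_restrictionMap [UniformSpace E] [IsUniformAddGroup E] [ContinuousSMul 𝕜 E]
    [T2Space E] [CompleteSpace E] (hconsistent : IsConsistentFamily TE TK)
    (hcompact : IsCompact (WeightedSpace.unitBall TK ν))
    {B : ℕ → Set (StrongDual 𝕜 E)} (hB : FixesTopology B)
    {U : Set ω} (hU : IsSetOfUniqueness TK ν U) :
    SurjOn (restrictionMap TE U) (epsWeightedSpace TK ν FE) (sbRestrictionSpace TK ν U B) := by
  rintro f ⟨hf, hbdd⟩
  obtain ⟨hT, hcons⟩ := hconsistent
  -- One choice of extension serves all `n`; outside `⋃ n, B n` it is the dummy `0`.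
  have hext (e' : StrongDual 𝕜 E) : ∃ g : WeightedSpace TK ν,
      ∀ n, e' ∈ B n → IsScalarExtension TK ν U f e' g := by
    by_cases he' : ∃ n, e' ∈ B n
    · obtain ⟨n, hn⟩ := he'
      obtain ⟨g, hg⟩ := hf e' (Submodule.subset_span (mem_iUnion_of_mem n hn))
      exact ⟨g, fun _ _ => hg⟩
    · exact ⟨0, fun n hn => (he' ⟨n, hn⟩).elim⟩
  choose g hg using hext
  choose C hC hCg using fun n => (hbdd n).exists_pos_norm_le
  have hdom (n : ℕ) (e' : StrongDual 𝕜 E) (he' : e' ∈ B n) (y : KappaDual 𝕜 F) (r : ℝ)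
      (hr : ∀ b ∈ WeightedSpace.unitBall TK ν, ‖y b‖ ≤ r) :
      ‖y (WeightedSpace.incl TK ν (g e'))‖ ≤ C n * r :=
    WeightedSpace.norm_map_incl_le (y : F →ₗ[𝕜] 𝕜) hr (hC n) (hCg n _ ⟨e', he', hg e' n he'⟩)
  obtain ⟨u, hu⟩ := hB.exists_epsProduct WeightedSpace.absConvex_unitBall hcompact
    (S := range fun x : U => KappaDual.mk (coordFunctional TK x) (hT x))
    (by
      rintro _ ⟨b, -, rfl⟩ h0
      rw [hU b fun x hx => h0 _ ⟨⟨x, hx⟩, rfl⟩, map_zero])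
    hC hdom
    (by
      rintro _ ⟨x, rfl⟩
      exact ⟨f x, fun n e' he' => (hg e' n he' x).symm⟩)
  obtain ⟨f', hf', hTE⟩ := hcons u
  refine ⟨f', ⟨u, ?_, hf'⟩, funext fun x => hB.eq_of_forall_apply_eq fun n e' he' => ?_⟩
  · refine hB.hasBasis.isVonNBounded_iff.2 fun n _ => ?_
    -- The domination with `r = 1` puts the image of the polar inside `C n` times the polar of `B
    -- n`.
    refine Absorbs.of_norm ⟨C n, fun c hc => ?_⟩
    rintro _ ⟨y, hy, rfl⟩
    have hc0 : 0 < ‖c‖ := (hC n).trans_le hc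
    rw [mem_smul_set_iff_inv_smul_mem₀ (norm_pos_iff.1 hc0)]
    intro e' he'
    rw [map_smul, norm_smul, norm_inv, inv_mul_le_iff₀ hc0, hu y n e' he', mul_one]
    exact (hdom n e' he' y 1 hy).trans (by rwa [mul_one])
  · rw [restrictionMap, hTE, hu _ n e' he']
    exact hg e' n he' x

end Restriction

theorem mainTheorem3
    {𝕜 : Type*} [RCLike 𝕜] {Ω ω : Type*} [Nonempty Ω] [Nonempty ω]
    -- `E` is a Fréchet space
    {E : Type*} [AddCommGroup E] [Module 𝕜 E] [UniformSpace E] [IsUniformAddGroup E]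
    [ContinuousSMul 𝕜 E] [PolynormableSpace 𝕜 E] [T2Space E] [FirstCountableTopology E]
    [CompleteSpace E]
    -- `F = F(Ω)` is a locally convex Hausdorff space of scalar functions with `δ_x ∈ F'`
    {F : Type*} [FunLike F Ω 𝕜] [AddCommGroup F] [Module 𝕜 F]
    [IsAddApply F Ω 𝕜] [IsSMulApply 𝕜 F Ω 𝕜]
    [TopologicalSpace F] [IsTopologicalAddGroup F] [ContinuousSMul 𝕜 F]
    [PolynormableSpace 𝕜 F] [T2Space F] [ContinuousEvalConst F Ω 𝕜]
    -- `FE = F(Ω, E)` is a locally convex Hausdorff space of `E`-valued functions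
    {FE : Type*} [FunLike FE Ω E] [AddCommGroup FE] [Module 𝕜 FE]
    [IsAddApply FE Ω E] [IsSMulApply 𝕜 FE Ω E]
    [TopologicalSpace FE] [IsTopologicalAddGroup FE] [ContinuousSMul 𝕜 FE]
    [PolynormableSpace 𝕜 FE] [T2Space FE]
    (hcompat : EpsIntoCompatible 𝕜 F E FE)
    (TE : FE →ₗ[𝕜] (ω → E)) (TK : F →ₗ[𝕜] (ω → 𝕜)) (ν : ω → Set.Ioi (0 : ℝ))
    (hstrong : IsStrongFamily TE TK) (hconsistent : IsConsistentFamily TE TK)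
    -- `Fν(Ω)` is a Banach space whose closed unit ball is compact in `F(Ω)`
    [T2Space (WeightedSpace TK ν)] [CompleteSpace (WeightedSpace TK ν)]
    (hcompact : IsCompact (WeightedSpace.unitBall TK ν))
    (B : ℕ → Set (StrongDual 𝕜 E)) (hB : FixesTopology B)
    (U : Set ω) (hU : IsSetOfUniqueness TK ν U) :
    Set.MapsTo (restrictionMap TE U) (epsWeightedSpace TK ν FE) (sbRestrictionSpace TK ν U B) ∧
      Set.SurjOn (restrictionMap TE U) (epsWeightedSpace TK ν FE)
        (sbRestrictionSpace TK ν U B) := 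
  ⟨mapsTo_restrictionMap hstrong hconsistent hB hU,
    surjOn_restrictionMap hconsistent hcompact hB hU⟩
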